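/- Let $Y_n$ be the Yangian of $\mathfrak{gl}_n$: the complex associative unital algebra generated by $t_{ij}^{(r)}$ ($1\le i,j\le n$, $r\ge 1$) subject to $$[t_{ij}^{(r+1)},t_{kl}^{(s)}]-[t_{ij}^{(r)},t_{kl}^{(s+1)}]=t_{kj}^{(r)}t_{il}^{(s)}-t_{kj}^{(s)}t_{il}^{(r)}\qquad(r,s\ge 0),$$ where $t_{ij}^{(0)}=\delta_{ij}$. For $a\in\mathbb C$ put $t_{ij}(u+a)=\sum_{r\ge0}t_{ij}^{(r)}(u+a)^{-r}\in Y_n[[u^{-1}]]$, where $(u+a)^{-r}$ is expanded as a power series in $u^{-1}$. For tuples $A=(a_1,\dots,a_m)$ and $B=(b_1,\dots,b_m)$ in $[n]^m$ define the Yangian minor $$t^A_B(u+a)=\sum_{\sigma\in\mathfrak S_m}(-1)^{\ell(\sigma)}\,t_{a_{\sigma(1)}b_1}(u+a)\,t_{a_{\sigma(2)}b_2}(u+a-1)\cdots t_{a_{\sigma(m)}b_m}(u+a-m+1).$$ A subset of $[n]=\{1,\dots,n\}$ is identified with the increasing tuple of its elements, $A|B$ denotes the concatenation of tuples, and $\ell(A)$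 is the number of inversions of a tuple $A$ of distinct integers (the minimal number of adjacent swaps that order it). **Proposition (Young Symmetry).** Let $0<p\le d\le e$ be integers, let $I\in[n]^{d-p}$ be any tuple, and let $J\subseteq[n]$ be a subset with $|J|=e+p$. Then in $Y_n[[u^{-1}]]$ $$\sum_{\Lambda\subseteq J,\ |\Lambda|=p}(-1)^{\ell(\Lambda|J\setminus\Lambda)}\,t^{[d]}_{I|\Lambda}(u+d)\cdot t^{[e]}_{J\setminus\Lambda}(u+e+1)=0$$ and $$\sum_{\Lambda\subseteq J,\ |\Lambda|=p}(-1)^{\ell(\Lambda|J\setminus\Lambda)}\,t^{[d]}_{I|\Lambda}(u+d)\cdot t^{[e]}_{J\setminus\Lambda}(u+e+p)=0.$$ -/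

import Mathlib

open scoped PowerSeries

/-- The elements `t_{ij}^{(r)}`, `r = 0, 1, 2, …`, of the free algebra on the symbols
`t_{ij}^{(r)}` with `r ≥ 1` (the symbol indexed by `(i, j, r)` stands for `t_{ij}^{(r+1)}`);
by convention `t_{ij}^{(0)} = δ_{ij}`. -/
noncomputable def yangianFreeGen (n : ℕ) (i j : Fin n) :
    ℕ → FreeAlgebra ℂ (Fin n × Fin n × ℕ)
  | 0 => if i = j then 1 else 0
  | r + 1 => FreeAlgebra.ι ℂ (i, j, r)

/-- The defining relations of the Yangian of `𝔤𝔩ₙ`. -/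
inductive YangianRel (n : ℕ) :
    FreeAlgebra ℂ (Fin n × Fin n × ℕ) → FreeAlgebra ℂ (Fin n × Fin n × ℕ) → Prop
  | rtt (i j k l : Fin n) (r s : ℕ) :
      YangianRel n
        (⁅yangianFreeGen n i j (r + 1), yangianFreeGen n k l s⁆
          - ⁅yangianFreeGen n i j r, yangianFreeGen n k l (s + 1)⁆)
        (yangianFreeGen n k j r * yangianFreeGen n i l s
          - yangianFreeGen n k j s * yangianFreeGen n i l r)

/-- The Yangian `Yₙ` of `𝔤𝔩ₙ`, as a complex associative unital algebra. -/
abbrev Yangian (n : ℕ) : Type := RingQuot (YangianRel n)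

namespace Yangian

variable {n : ℕ}

/-- The generator `t_{ij}^{(r)}` of the Yangian, with `t_{ij}^{(0)} = δ_{ij}`. -/
noncomputable def gen (i j : Fin n) (r : ℕ) : Yangian n :=
  RingQuot.mkAlgHom ℂ (YangianRel n) (yangianFreeGen n i j r)

/-- The expansion of `(u + a)⁻¹ = u⁻¹ (1 + a u⁻¹)⁻¹` as a power series in the variable
`X = u⁻¹`. -/
noncomputable def shiftedInv (a : ℂ) : ℂ⟦X⟧ :=
  PowerSeries.X * (1 + PowerSeries.C a * PowerSeries.X)⁻¹

/-- The series `t_{ij}(u + a) = ∑_p t_{ij}^{(p)} (u + a)^{-p}`, expanded as a power series in the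
(central) variable `X = u⁻¹`. The terms with `p > m` do not contribute to the coefficient of
`u^{-m}`, since `(u + a)^{-p}` is divisible by `u^{-p}`. -/
noncomputable def series (i j : Fin n) (a : ℂ) : (Yangian n)⟦X⟧ :=
  PowerSeries.mk fun m =>
    ∑ p ∈ Finset.range (m + 1), PowerSeries.coeff m (shiftedInv a ^ p) • gen i j p

/-- The Yangian minor `t^I_J(u + a)` of the tuples `I, J ∈ [n]^d`:
`∑_σ (-1)^{ℓ(σ)} t_{i_{σ(1)} j_1}(u + a) t_{i_{σ(2)} j_2}(u + a - 1) ⋯ t_{i_{σ(d)} j_d}(u + a - d + 1)`,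
the factors being multiplied in this order. -/
noncomputable def minor {d : ℕ} (I J : Fin d → Fin n) (a : ℂ) : (Yangian n)⟦X⟧ :=
  ∑ σ : Equiv.Perm (Fin d),
    (Equiv.Perm.sign σ : ℤ) •
      (List.ofFn fun k : Fin d => series (I (σ k)) (J k) (a - (k : ℕ))).prod

/-- The minor `t^{[d]}_J(u + a)`, on the first `d` rows. -/
noncomputable def topMinor {d : ℕ} (hd : d ≤ n) (J : Fin d → Fin n) (a : ℂ) : (Yangian n)⟦X⟧ :=
  minor (Fin.castLE hd) J a

/-- The length `ℓ(K)` of a tuple `K` of distinct integers, i.e. its number of inversions, which is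
the minimal number of adjacent swaps needed to order it. -/
def tupleLength {m : ℕ} (K : Fin m → Fin n) : ℕ :=
  (Finset.univ.filter fun q : Fin m × Fin m => q.1 < q.2 ∧ K q.2 < K q.1).card

theorem card_sdiff_eq {e p : ℕ} {J Λ : Finset (Fin n)} (hJ : J.card = e + p)
    (hΛ : Λ ⊆ J ∧ Λ.card = p) : (J \ Λ).card = e := by
  rw [Finset.card_sdiff_of_subset hΛ.1, hJ, hΛ.2, Nat.add_sub_cancel]

theorem le_of_card_eq {e p : ℕ} {J : Finset (Fin n)} (hJ : J.card = e + p) : e ≤ n :=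
  (Nat.le_add_right e p).trans (hJ ▸ card_finset_fin_le J)

/-- The Young symmetry sum
`∑_{Λ ⊆ J, |Λ| = p} (-1)^{ℓ(Λ | J∖Λ)} t^{[d]}_{I | Λ}(u + a) t^{[e]}_{J∖Λ}(u + b)`,
for `I ∈ [n]^{d-p}` and a subset `J ⊆ [n]` of size `e + p`, where `p ≤ d ≤ e`. Here `|` is the
concatenation of tuples, and a set stands for the increasing tuple of its elements. -/
noncomputable def youngSum {d e p : ℕ} (hpd : p ≤ d) (hde : d ≤ e) (I : Fin (d - p) → Fin n)
    (J : Finset (Fin n)) (hJ : J.card = e + p) (a b : ℂ) : (Yangian n)⟦X⟧ :=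
  ∑ Λ : {Λ : Finset (Fin n) // Λ ⊆ J ∧ Λ.card = p},
    (-1) ^ tupleLength (Fin.append (Λ.1.orderEmbOfFin Λ.2.2)
        ((J \ Λ.1).orderEmbOfFin (card_sdiff_eq hJ Λ.2))) *
      (topMinor (hde.trans (le_of_card_eq hJ))
          (fun k => Fin.append I (Λ.1.orderEmbOfFin Λ.2.2)
            (Fin.cast (Nat.sub_add_cancel hpd).symm k)) a *
        topMinor (le_of_card_eq hJ)
          (fun k => (J \ Λ.1).orderEmbOfFin (card_sdiff_eq hJ Λ.2) k) b)

end Yangian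

/-!
The proof uses only the relation
`(a - b) [t_{ij}(u+a), t_{kl}(u+b)] = t_{kj}(u+a) t_{il}(u+b) - t_{kj}(u+b) t_{il}(u+a)`
between the shifted generating series (`Yangian.isRTT_series`). It follows from the defining
relations by expanding both sides, multiplied by `x y`, in powers of `x = (u+a)⁻¹` and
`y = (u+b)⁻¹`, since `y - x = (a - b) x y`.

The relation implies that a Yangian minor, defined as a row antisymmetrization with decreasing
parameters, is also the column antisymmetrization with increasing parameters
(`RTT.rowAlt_eq_colAlt`). Indeed, the antisymmetrization of `t(u+c₁) ⊗ ⋯ ⊗ t(u+cₘ)` in rows and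
columns does not depend on the order of the parameters (`RTT.biAlt_comp`), and for parameters in
steps of one it is `m!` times either of the one-sided antisymmetrizations. The row form has a
Laplace expansion in columns, the column form one in rows.

Second symmetry. The Laplace expansion of `t^{[d]}_{I|Λ}(u+d)` splits off minors
`t^K_Λ(u+p)` with `K ⊆ [d] ⊆ [e]`. For each of them, the alternating sum over `Λ` of
`t^K_Λ(u+p) t^{[e]}_{J∖Λ}(u+e+p)` is, in column form, the Laplace expansion of a minor with rows
`K|[e]`, which vanishes because it has a repeated row
(`RTT.sum_sign_smul_minor_mul_minor_eq_zero`).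

First symmetry. For `p = 1` it is the second one. In general, fixing the first `p - 1` of the
exchanged columns leaves a symmetry with one exchanged column, and summing these gives a
nonzero multiple of the claim (`RTT.sum_sign_smul_rowAlt_append_eq_zero'`).

The expansions are carried out for signed sums over all rearrangements of `J`, which are
`p! e!` times the signed sums over the subsets `Λ`
(`Yangian.sum_sign_smul_comp_orderEmbOfFin`).
-/

namespace RTT

open Equiv Equiv.Perm

/-! ### Signed sums over symmetric groups -/

@[simp] theorem sign_smul_sign_smul {m : ℕ} {M : Type*} [AddCommGroup M] (σ : Perm (Fin m))
    (x : M) : (sign σ : ℤ) • (sign σ : ℤ) • x = x := by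
  rw [smul_smul, ← Units.val_mul, Int.units_mul_self, Units.val_one, one_smul]

/-- Averaging a signed sum over right translates by a family `φ` of permutations. -/
theorem card_smul_sum_sign {m : ℕ} {M H : Type*} [AddCommGroup M] [Fintype H]
    (φ : H → Perm (Fin m)) (f : Perm (Fin m) → M) :
    Fintype.card H • ∑ σ, (sign σ : ℤ) • f σ =
      ∑ σ, (sign σ : ℤ) • ∑ h, (sign (φ h) : ℤ) • f (σ * φ h) := by
  simp_rw [Finset.smul_sum]
  rw [Finset.sum_comm, ← Finset.card_univ, ← Finset.smul_sum, ← Finset.sum_const]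
  refine Finset.sum_congr rfl fun h _ => ?_
  rw [← Equiv.sum_comp (Equiv.mulRight (φ h))]
  simp [mul_smul]

theorem two_smul_sum_sign {m : ℕ} {M : Type*} [AddCommGroup M] {s : Perm (Fin m)}
    (hs : sign s = -1) (f : Perm (Fin m) → M) :
    2 • ∑ σ, (sign σ : ℤ) • f σ = ∑ σ, (sign σ : ℤ) • (f σ - f (σ * s)) := by
  simpa [hs, sub_eq_add_neg] using card_smul_sum_sign (fun b : Bool => if b then 1 else s) f

/-- A function of tuples which is multiplied by `χ s` when its argument is composed with an
adjacent transposition `s` is multiplied by `χ β` for every permutation `β`. -/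
theorem comp_perm_of_adjacent {m : ℕ} {X M : Type*} [AddCommGroup M] (χ : Perm (Fin m) →* ℤˣ)
    (Φ : (Fin m → X) → M)
    (h : ∀ (B : Fin m → X) (i j : Fin m), (j : ℕ) = i + 1 →
      Φ (B ∘ swap i j) = (χ (swap i j) : ℤ) • Φ B)
    (β : Perm (Fin m)) (B : Fin m → X) : Φ (B ∘ β) = (χ β : ℤ) • Φ B := by
  -- The generation by adjacent transpositions is available on `Fin (m + 1)` only.
  rcases m with _ | m
  · rw [Subsingleton.elim β 1]
    simp
  have hβ : β ∈ Submonoid.closure (Set.range fun i : Fin m => swap i.castSucc i.succ) := by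
    rw [mclosure_swap_castSucc_succ]
    trivial
  induction hβ using Submonoid.closure_induction generalizing B with
  | mem x hx =>
    obtain ⟨i, rfl⟩ := hx
    exact h B _ _ (by simp)
  | one => simp
  | mul x y _ _ hx hy =>
    rw [Perm.coe_mul, ← Function.comp_assoc, hy, hx, smul_smul, map_mul, mul_comm (χ x)]
    simp

/-- The permutation of `Fin (p + e)` acting by `α` on the first `p` and by `β` on the last `e`
indices. -/
def blockPerm {p e : ℕ} (α : Perm (Fin p)) (β : Perm (Fin e)) : Perm (Fin (p + e)) :=
  finSumFinEquiv.permCongr (Perm.sumCongr α β)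

@[simp] theorem blockPerm_castAdd {p e : ℕ} (α : Perm (Fin p)) (β : Perm (Fin e)) (k : Fin p) :
    blockPerm α β (Fin.castAdd e k) = Fin.castAdd e (α k) := by
  simp [blockPerm, Equiv.permCongr_apply]

@[simp] theorem blockPerm_natAdd {p e : ℕ} (α : Perm (Fin p)) (β : Perm (Fin e)) (k : Fin e) :
    blockPerm α β (Fin.natAdd p k) = Fin.natAdd p (β k) := by
  simp [blockPerm, Equiv.permCongr_apply]

@[simp] theorem sign_blockPerm {p e : ℕ} (α : Perm (Fin p)) (β : Perm (Fin e)) :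
    sign (blockPerm α β) = sign α * sign β := by
  rw [blockPerm, sign_permCongr, sign_sumCongr]

/-! ### Matrices of generating series and their words -/

/-- The relation `(a - b) [T_{ij}(a), T_{kl}(b)] = T_{kj}(a) T_{il}(b) - T_{kj}(b) T_{il}(a)`
for a matrix `T` of functions of a complex parameter, with values in a complex algebra. -/
def IsRTT {ι R : Type*} [Ring R] [Algebra ℂ R] (T : ι → ι → ℂ → R) : Prop :=
  ∀ (i j k l : ι) (a b : ℂ), (a - b) • (T i j a * T k l b - T k l b * T i j a) =
    T k j a * T i l b - T k j b * T i l a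

section

variable {ι R : Type*} [Ring R] (T : ι → ι → ℂ → R)

/-- The ordered product `T_{A₁B₁}(c₁) T_{A₂B₂}(c₂) ⋯`. -/
def word {m : ℕ} (c : Fin m → ℂ) (A B : Fin m → ι) : R :=
  (List.ofFn fun k => T (A k) (B k) (c k)).prod

/-- The antisymmetrization of a word in its row indices. -/
def rowAlt {m : ℕ} (c : Fin m → ℂ) (A B : Fin m → ι) : R :=
  ∑ σ : Perm (Fin m), (sign σ : ℤ) • word T c (A ∘ σ) B

/-- The antisymmetrization of a word in its column indices. -/
def colAlt {m : ℕ} (c : Fin m → ℂ) (A B : Fin m → ι) : R :=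
  ∑ τ : Perm (Fin m), (sign τ : ℤ) • word T c A (B ∘ τ)

/-- The antisymmetrization of a word in its row and column indices. -/
def biAlt {m : ℕ} (c : Fin m → ℂ) (A B : Fin m → ι) : R :=
  ∑ σ : Perm (Fin m), (sign σ : ℤ) • colAlt T c (A ∘ σ) B

end

/-- A product of an ordered list of factors, as a function of two neighbouring factors. -/
theorem exists_prod_ofFn_eq {R : Type*} [Monoid R] {m : ℕ} (f₀ : Fin m → R) {i j : Fin m}
    (hij : (j : ℕ) = i + 1) :
    ∃ P Q : R, ∀ f : Fin m → R, (∀ k, k ≠ i → k ≠ j → f k = f₀ k) →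
      (List.ofFn f).prod = P * (f i * f j) * Q := by
  induction m with
  | zero => exact i.elim0
  | succ m ih =>
    induction i using Fin.cases with
    | zero =>
      rcases m with _ | m
      · exact absurd j.isLt (by rw [hij]; simp)
      · obtain rfl : j = 1 := Fin.ext (by simpa using hij)
        refine ⟨1, (List.ofFn fun k : Fin m => f₀ k.succ.succ).prod, fun f hf => ?_⟩
        simp only [List.ofFn_succ, List.prod_cons, one_mul, mul_assoc]
        congr 4
        funext k
        exact hf _ (by simp) (by simp [Fin.ext_iff])
    | succ i =>
      induction j using Fin.cases with
      | zero => simp at hij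
      | succ j =>
        obtain ⟨P, Q, h⟩ := ih (fun k => f₀ k.succ) (i := i) (j := j) (by simpa using hij)
        refine ⟨f₀ 0 * P, Q, fun f hf => ?_⟩
        rw [List.ofFn_succ, List.prod_cons, h (fun k => f k.succ), hf 0]
        · simp only [mul_assoc]
        · exact (Fin.succ_ne_zero _).symm
        · exact (Fin.succ_ne_zero _).symm
        · exact fun k hi hj => hf _ (by simpa using hi) (by simpa using hj)

variable {ι R : Type*} [Ring R] {T : ι → ι → ℂ → R}

theorem exists_word_eq (T : ι → ι → ℂ → R) {m : ℕ} (c : Fin m → ℂ) (A B : Fin m → ι)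
    {i j : Fin m} (hij : (j : ℕ) = i + 1) :
    ∃ P Q : R, ∀ (c' : Fin m → ℂ) (A' B' : Fin m → ι),
      (∀ k, k ≠ i → k ≠ j → c' k = c k ∧ A' k = A k ∧ B' k = B k) →
      word T c' A' B' =
        P * (T (A' i) (B' i) (c' i) * T (A' j) (B' j) (c' j)) * Q := by
  obtain ⟨P, Q, h⟩ := exists_prod_ofFn_eq (fun k => T (A k) (B k) (c k)) hij
  refine ⟨P, Q, fun c' A' B' h' => h _ fun k hi hj => ?_⟩
  obtain ⟨h₁, h₂, h₃⟩ := h' k hi hj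
  simp only [h₁, h₂, h₃]

/-- The four words obtained from one word by exchanging neighbouring rows or columns, and the
same four words with the two parameters exchanged as well. -/
theorem exists_word_swap_eq (T : ι → ι → ℂ → R) {m : ℕ} (c : Fin m → ℂ) (A B : Fin m → ι)
    {i j : Fin m} (hij : (j : ℕ) = i + 1) :
    ∃ P Q : R,
      (word T c A B = P * (T (A i) (B i) (c i) * T (A j) (B j) (c j)) * Q ∧
      word T c (A ∘ swap i j) B = P * (T (A j) (B i) (c i) * T (A i) (B j) (c j)) * Q ∧
      word T c A (B ∘ swap i j) = P * (T (A i) (B j) (c i) * T (A j) (B i) (c j)) * Q ∧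
      word T c (A ∘ swap i j) (B ∘ swap i j) =
        P * (T (A j) (B j) (c i) * T (A i) (B i) (c j)) * Q) ∧
      (word T (c ∘ swap i j) A B = P * (T (A i) (B i) (c j) * T (A j) (B j) (c i)) * Q ∧
      word T (c ∘ swap i j) (A ∘ swap i j) B =
        P * (T (A j) (B i) (c j) * T (A i) (B j) (c i)) * Q ∧
      word T (c ∘ swap i j) A (B ∘ swap i j) =
        P * (T (A i) (B j) (c j) * T (A j) (B i) (c i)) * Q ∧
      word T (c ∘ swap i j) (A ∘ swap i j) (B ∘ swap i j) =
        P * (T (A j) (B j) (c j) * T (A i) (B i) (c i)) * Q) := by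
  obtain ⟨P, Q, h⟩ := exists_word_eq T c A B hij
  refine ⟨P, Q, ⟨?_, ?_, ?_, ?_⟩, ?_, ?_, ?_, ?_⟩ <;>
  · refine (h _ _ _ fun k hi hj => by simp [swap_apply_of_ne_of_ne hi hj]).trans ?_
    simp only [Function.comp_apply, swap_apply_left, swap_apply_right]

theorem word_add {p e : ℕ} (c : Fin (p + e) → ℂ) (A B : Fin (p + e) → ι) :
    word T c A B =
      word T (c ∘ Fin.castAdd e) (A ∘ Fin.castAdd e) (B ∘ Fin.castAdd e) *
        word T (c ∘ Fin.natAdd p) (A ∘ Fin.natAdd p) (B ∘ Fin.natAdd p) := by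
  rw [word, List.ofFn_add, List.prod_append]
  rfl

/-! ### Antisymmetry of quantum minors -/

theorem sign_swap_adjacent {m : ℕ} {i j : Fin m} (hij : (j : ℕ) = i + 1) :
    sign (swap i j) = -1 :=
  sign_swap fun h => by simp [h] at hij

theorem biAlt_eq_sum_rowAlt {m : ℕ} (c : Fin m → ℂ) (A B : Fin m → ι) :
    biAlt T c A B = ∑ τ : Perm (Fin m), (sign τ : ℤ) • rowAlt T c A (B ∘ τ) := by
  simp only [biAlt, rowAlt, colAlt, Finset.smul_sum]
  rw [Finset.sum_comm]
  refine Finset.sum_congr rfl fun τ _ => Finset.sum_congr rfl fun σ _ => ?_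
  rw [smul_comm]

variable [Algebra ℂ R]

theorem eq_zero_of_nsmul {k : ℕ} (hk : k ≠ 0) {x : R} (h : k • x = 0) : x = 0 := by
  rw [← Nat.cast_smul_eq_nsmul ℂ] at h
  have hk' : (k : ℂ) ≠ 0 := by exact_mod_cast hk
  rw [← inv_smul_smul₀ hk' x, h, smul_zero]

theorem eq_of_nsmul {k : ℕ} (hk : k ≠ 0) {x y : R} (h : k • x = k • y) : x = y :=
  sub_eq_zero.1 (eq_zero_of_nsmul hk (by rw [smul_sub, h, sub_self]))

/-- For parameters differing by one, the relation equates a row antisymmetrization with a column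
antisymmetrization of the factors in the opposite order. -/
theorem IsRTT.two_minor (hT : IsRTT T) (i j k l : ι) {a b : ℂ} (hab : a - b = 1) :
    T i j a * T k l b - T k j a * T i l b = T k l b * T i j a - T k j b * T i l a := by
  have h := hT i j k l a b
  rw [hab, one_smul] at h
  rw [sub_eq_iff_eq_add] at h ⊢
  rw [h]
  abel

/-- The double antisymmetrization of `T(a) ⊗ T(b)` is symmetric in `a` and `b`. -/
theorem IsRTT.quad_comm (hT : IsRTT T) (r r' s s' : ι) (a b : ℂ) :
    T r s a * T r' s' b - T r' s a * T r s' b - T r s' a * T r' s b + T r' s' a * T r s b =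
      T r s b * T r' s' a - T r' s b * T r s' a - T r s' b * T r' s a + T r' s' b * T r s a := by
  have key : ∀ a b : ℂ, (a - b + 1) •
      ((T r s a * T r' s' b - T r' s a * T r s' b - T r s' a * T r' s b + T r' s' a * T r s b) -
      (T r s b * T r' s' a - T r' s b * T r s' a - T r s' b * T r' s a + T r' s' b * T r s a))
      = 0 := by
    intro a b
    have h₁ := hT r s r' s' a b
    have h₂ := hT r' s r s' a b
    have h₃ := hT r s' r' s a b
    have h₄ := hT r' s' r s a b
    rw [add_smul, one_smul]
    have h : (a - b) •
        ((T r s a * T r' s' b - T r' s a * T r s' b - T r s' a * T r' s b + T r' s' a * T r s b) -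
        (T r s b * T r' s' a - T r' s b * T r s' a - T r s' b * T r' s a + T r' s' b * T r s a))
        = (a - b) • (T r s a * T r' s' b - T r' s' b * T r s a)
          - (a - b) • (T r' s a * T r s' b - T r s' b * T r' s a)
          - (a - b) • (T r s' a * T r' s b - T r' s b * T r s' a)
          + (a - b) • (T r' s' a * T r s b - T r s b * T r' s' a) := by
      simp only [← smul_sub, ← smul_add]
      congr 1
      abel
    rw [h, h₁, h₂, h₃, h₄]
    abel
  have conclude : ∀ a b : ℂ, a - b + 1 ≠ 0 →
      T r s a * T r' s' b - T r' s a * T r s' b - T r s' a * T r' s b + T r' s' a * T r s b =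
      T r s b * T r' s' a - T r' s b * T r s' a - T r s' b * T r' s a + T r' s' b * T r s a := by
    intro a b hab
    have h := congrArg (fun x => (a - b + 1)⁻¹ • x) (key a b)
    simp only [inv_smul_smul₀ hab, smul_zero] at h
    exact sub_eq_zero.1 h
  -- The factors for `(a, b)` and `(b, a)` do not vanish simultaneously.
  by_cases hab : a - b + 1 = 0
  · refine (conclude b a fun h => ?_).symm
    have : (2 : ℂ) = 0 := by linear_combination hab + h
    norm_num at this
  · exact conclude a b hab

theorem rowAlt_comp_col (hT : IsRTT T) {m : ℕ} {c : Fin m → ℂ}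
    (hc : ∀ i j : Fin m, (j : ℕ) = i + 1 → c i - c j = 1) (A B : Fin m → ι)
    (β : Perm (Fin m)) : rowAlt T c A (B ∘ β) = (sign β : ℤ) • rowAlt T c A B := by
  refine comp_perm_of_adjacent sign (fun B => rowAlt T c A B) (fun B i j hij => ?_) β B
  rw [sign_swap_adjacent hij, Units.val_neg, Units.val_one, neg_one_smul, eq_neg_iff_add_eq_zero]
  refine eq_zero_of_nsmul two_ne_zero ?_
  rw [rowAlt, rowAlt, ← Finset.sum_add_distrib]
  simp_rw [← smul_add]
  rw [two_smul_sum_sign (sign_swap_adjacent hij)]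
  refine Finset.sum_eq_zero fun σ _ => ?_
  obtain ⟨P, Q, ⟨h₁, h₂, h₃, h₄⟩, -⟩ := exists_word_swap_eq T c (A ∘ σ) B hij
  rw [Perm.coe_mul, ← Function.comp_assoc, h₁, h₂, h₃, h₄]
  simp only [← mul_add, ← add_mul, ← mul_sub, ← sub_mul]
  have e₁ := hT.two_minor ((A ∘ σ) i) (B i) ((A ∘ σ) j) (B j) (hc i j hij)
  have e₂ := hT.two_minor ((A ∘ σ) i) (B j) ((A ∘ σ) j) (B i) (hc i j hij)
  refine (congrArg (fun x => (sign σ : ℤ) • (P * x * Q)) (?_ : _ = (0 : R))).trans (by simp)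
  linear_combination (norm := abel) e₁ + e₂

theorem colAlt_comp_row (hT : IsRTT T) {m : ℕ} {c : Fin m → ℂ}
    (hc : ∀ i j : Fin m, (j : ℕ) = i + 1 → c j - c i = 1) (A B : Fin m → ι)
    (α : Perm (Fin m)) : colAlt T c (A ∘ α) B = (sign α : ℤ) • colAlt T c A B := by
  refine comp_perm_of_adjacent sign (fun A => colAlt T c A B) (fun A i j hij => ?_) α A
  rw [sign_swap_adjacent hij, Units.val_neg, Units.val_one, neg_one_smul, eq_neg_iff_add_eq_zero]
  refine eq_zero_of_nsmul two_ne_zero ?_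
  rw [colAlt, colAlt, ← Finset.sum_add_distrib]
  simp_rw [← smul_add]
  rw [two_smul_sum_sign (sign_swap_adjacent hij)]
  refine Finset.sum_eq_zero fun τ _ => ?_
  obtain ⟨P, Q, ⟨h₁, h₂, h₃, h₄⟩, -⟩ := exists_word_swap_eq T c A (B ∘ τ) hij
  rw [Perm.coe_mul, ← Function.comp_assoc, h₁, h₂, h₃, h₄]
  simp only [← mul_add, ← add_mul, ← mul_sub, ← sub_mul]
  have e₁ := hT.two_minor (A i) ((B ∘ τ) j) (A j) ((B ∘ τ) i) (hc i j hij)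
  have e₂ := hT.two_minor (A j) ((B ∘ τ) j) (A i) ((B ∘ τ) i) (hc i j hij)
  refine (congrArg (fun x => (sign τ : ℤ) • (P * x * Q)) (?_ : _ = (0 : R))).trans (by simp)
  linear_combination (norm := abel) -e₁ - e₂

theorem biAlt_comp (hT : IsRTT T) {m : ℕ} (c : Fin m → ℂ) (A B : Fin m → ι)
    (γ : Perm (Fin m)) : biAlt T (c ∘ γ) A B = biAlt T c A B := by
  refine (comp_perm_of_adjacent 1 (fun c => biAlt T c A B) (fun c i j hij => ?_) γ c).trans
    (by simp)
  have hs := sign_swap_adjacent hij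
  -- Averaging over the exchange of the rows and of the columns at the places `i`, `j` reduces the
  -- claim to the symmetry of the double antisymmetrization of two factors.
  have four : ∀ c : Fin m → ℂ, 2 • 2 • biAlt T c A B =
      ∑ σ : Perm (Fin m), (sign σ : ℤ) • ∑ τ : Perm (Fin m), (sign τ : ℤ) •
        ((word T c (A ∘ σ) (B ∘ τ) - word T c (A ∘ σ ∘ swap i j) (B ∘ τ)) -
        (word T c (A ∘ σ) (B ∘ τ ∘ swap i j) -
          word T c (A ∘ σ ∘ swap i j) (B ∘ τ ∘ swap i j))) := by
    intro c
    rw [biAlt, two_smul_sum_sign hs, Finset.smul_sum]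
    refine Finset.sum_congr rfl fun σ _ => ?_
    rw [smul_comm, colAlt, colAlt, ← Finset.sum_sub_distrib]
    simp_rw [← smul_sub]
    rw [two_smul_sum_sign hs]
    rfl
  refine eq_of_nsmul two_ne_zero (eq_of_nsmul two_ne_zero ?_)
  rw [four]
  simp only [MonoidHom.one_apply, Units.val_one, one_smul]
  rw [four]
  refine Finset.sum_congr rfl fun σ _ => congrArg _ (Finset.sum_congr rfl fun τ _ =>
    congrArg _ ?_)
  obtain ⟨P, Q, ⟨h₁, h₂, h₃, h₄⟩, h₅, h₆, h₇, h₈⟩ := exists_word_swap_eq T c (A ∘ σ) (B ∘ τ) hij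
  rw [← Function.comp_assoc, ← Function.comp_assoc, h₁, h₂, h₃, h₄, h₅, h₆, h₇, h₈]
  simp only [← mul_sub, ← sub_mul]
  congr 2
  have h := hT.quad_comm ((A ∘ σ) i) ((A ∘ σ) j) ((B ∘ τ) i) ((B ∘ τ) j) (c j) (c i)
  simpa only [sub_sub_eq_add_sub, sub_add_eq_add_sub, sub_sub, sub_add] using h

/-- The two expressions of a quantum minor: as a row antisymmetrization with decreasing
parameters, and as a column antisymmetrization with increasing parameters. -/
theorem rowAlt_eq_colAlt (hT : IsRTT T) {m : ℕ} {c : Fin m → ℂ}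
    (hc : ∀ i j : Fin m, (j : ℕ) = i + 1 → c i - c j = 1) (A B : Fin m → ι) :
    rowAlt T c A B = colAlt T (c ∘ Fin.rev) A B := by
  have hm : Fintype.card (Perm (Fin m)) ≠ 0 := Fintype.card_ne_zero
  have hc' : ∀ i j : Fin m, (j : ℕ) = i + 1 → (c ∘ Fin.rev) j - (c ∘ Fin.rev) i = 1 :=
    fun i j hij => hc _ _ (by simp only [Fin.val_rev]; omega)
  refine eq_of_nsmul hm ?_
  have h₁ : biAlt T c A B = Fintype.card (Perm (Fin m)) • rowAlt T c A B := by
    rw [biAlt_eq_sum_rowAlt]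
    simp only [rowAlt_comp_col hT hc, sign_smul_sign_smul, Finset.sum_const, Finset.card_univ]
  have h₂ : biAlt T (c ∘ Fin.rev) A B =
      Fintype.card (Perm (Fin m)) • colAlt T (c ∘ Fin.rev) A B := by
    rw [biAlt]
    simp only [colAlt_comp_row hT hc', sign_smul_sign_smul, Finset.sum_const, Finset.card_univ]
  rw [← h₁, ← h₂]
  exact (biAlt_comp hT c A B Fin.revPerm).symm

theorem colAlt_eq_zero (hT : IsRTT T) {m : ℕ} {c : Fin m → ℂ}
    (hc : ∀ i j : Fin m, (j : ℕ) = i + 1 → c j - c i = 1) {A : Fin m → ι} (B : Fin m → ι)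
    {i j : Fin m} (hij : i ≠ j) (hA : A i = A j) : colAlt T c A B = 0 := by
  have h := colAlt_comp_row hT hc A B (swap i j)
  have hs : A ∘ swap i j = A := by
    funext k
    by_cases hi : k = i
    · simp [hi, hA]
    by_cases hj : k = j
    · simp [hj, hA]
    simp [swap_apply_of_ne_of_ne hi hj]
  rw [hs, sign_swap hij, Units.val_neg, Units.val_one, neg_one_smul, eq_neg_iff_add_eq_zero,
    ← two_nsmul] at h
  exact eq_zero_of_nsmul two_ne_zero h

end RTT

namespace RTT

open Equiv Equiv.Perm

/-! ### Laplace expansions and the Young symmetries as sums over permutations -/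

/-- The decreasing parameters `a, a - 1, a - 2, …` of a quantum minor. -/
def desc (a : ℂ) (m : ℕ) (k : Fin m) : ℂ := a - (k : ℕ)

theorem desc_sub_desc {a : ℂ} {m : ℕ} (i j : Fin m) (hij : (j : ℕ) = i + 1) :
    desc a m i - desc a m j = 1 := by
  simp [desc, hij]

variable {ι R : Type*} [Ring R] {T : ι → ι → ℂ → R}

/-- Laplace expansion of a row antisymmetrization along its last `p` columns. -/
theorem card_smul_rowAlt_append {q p : ℕ} (c : Fin (q + p) → ℂ) (A : Fin (q + p) → ι)
    (I : Fin q → ι) (L : Fin p → ι) :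
    Fintype.card (Perm (Fin p)) • rowAlt T c A (Fin.append I L) =
      ∑ σ : Perm (Fin (q + p)), (sign σ : ℤ) •
        (word T (c ∘ Fin.castAdd p) (A ∘ σ ∘ Fin.castAdd p) I *
          rowAlt T (c ∘ Fin.natAdd q) (A ∘ σ ∘ Fin.natAdd q) L) := by
  rw [rowAlt, card_smul_sum_sign (fun α => blockPerm 1 α)]
  refine Finset.sum_congr rfl fun σ _ => congrArg _ ?_
  rw [rowAlt, Finset.mul_sum]
  refine Finset.sum_congr rfl fun α _ => ?_
  rw [word_add, mul_smul_comm, sign_blockPerm, map_one, one_mul]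
  congr 3
  · funext k
    simp
  · funext k
    simp
  · funext k
    simp
  · funext k
    simp

/-- Laplace expansion of a column antisymmetrization along its first `p` rows. -/
theorem sum_sign_smul_colAlt_mul_colAlt {p e : ℕ} (c : Fin (p + e) → ℂ) (A J : Fin (p + e) → ι) :
    ∑ ρ : Perm (Fin (p + e)), (sign ρ : ℤ) •
        (colAlt T (c ∘ Fin.castAdd e) (A ∘ Fin.castAdd e) (J ∘ ρ ∘ Fin.castAdd e) *
          colAlt T (c ∘ Fin.natAdd p) (A ∘ Fin.natAdd p) (J ∘ ρ ∘ Fin.natAdd p)) =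
      Fintype.card (Perm (Fin p) × Perm (Fin e)) • colAlt T c A J := by
  rw [colAlt, card_smul_sum_sign (fun h : Perm (Fin p) × Perm (Fin e) => blockPerm h.1 h.2)]
  refine Finset.sum_congr rfl fun σ _ => congrArg _ ?_
  rw [colAlt, colAlt, Finset.sum_mul_sum, Fintype.sum_prod_type]
  refine Finset.sum_congr rfl fun α _ => Finset.sum_congr rfl fun β _ => ?_
  rw [word_add, sign_blockPerm, smul_mul_smul_comm, ← Units.val_mul]
  congr 3
  · funext k
    simp
  · funext k
    simp

variable [Algebra ℂ R]

/-- Alternating the product of the minors with rows `K` and `E` over all their columns gives a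
multiple of the minor with rows `K|E`, which vanishes as soon as `K` and `E` have a row in
common. -/
theorem sum_sign_smul_minor_mul_minor_eq_zero (hT : IsRTT T) {p e : ℕ} (a : ℂ) (K : Fin p → ι)
    (E : Fin e → ι) (J : Fin (p + e) → ι) {i : Fin p} {j : Fin e} (h : K i = E j) :
    ∑ ρ : Perm (Fin (p + e)), (sign ρ : ℤ) •
        (rowAlt T (desc a p) K (J ∘ ρ ∘ Fin.castAdd e) *
          rowAlt T (desc (a + e) e) E (J ∘ ρ ∘ Fin.natAdd p)) = 0 := by
  -- The increasing parameters `a - p + 1, …, a` and `a + 1, …, a + e` of the two column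
  -- antisymmetrizations fit together to those of one minor of size `p + e`.
  let c : Fin (p + e) → ℂ := fun k => a - p + 1 + (k : ℕ)
  have hc₁ : desc a p ∘ Fin.rev = c ∘ Fin.castAdd e := by
    funext k
    simp only [Function.comp_apply, desc, Fin.val_rev, c, Fin.val_castAdd]
    rw [Nat.cast_sub (by omega)]
    push_cast
    ring
  have hc₂ : desc (a + e) e ∘ Fin.rev = c ∘ Fin.natAdd p := by
    funext k
    simp only [Function.comp_apply, desc, Fin.val_rev, c, Fin.val_natAdd]
    rw [Nat.cast_sub (by omega)]
    push_cast
    ring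
  have key := sum_sign_smul_colAlt_mul_colAlt (T := T) c (Fin.append K E) J
  have hK : Fin.append K E ∘ Fin.castAdd e = K := by
    funext k
    simp
  have hE : Fin.append K E ∘ Fin.natAdd p = E := by
    funext k
    simp
  have hij : Fin.castAdd e i ≠ Fin.natAdd p j := by
    rw [Ne, Fin.ext_iff, Fin.val_castAdd, Fin.val_natAdd]
    omega
  rw [hK, hE, ← hc₁, ← hc₂, colAlt_eq_zero hT (fun i j hij => by simp [c, hij]) J hij
    (by simpa using h), smul_zero] at key
  simpa only [rowAlt_eq_colAlt hT desc_sub_desc] using key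

/-- The Young symmetry with parameters `u + d`, `u + e + p`, as a sum over permutations of an
arbitrary tuple `J`. -/
theorem sum_sign_smul_rowAlt_append_eq_zero (hT : IsRTT T) {q p e : ℕ} (hp : 0 < p) (a : ℂ)
    (A : Fin (q + p) → ι) (E : Fin e → ι) (hAE : Set.range A ⊆ Set.range E)
    (I : Fin q → ι) (J : Fin (p + e) → ι) :
    ∑ ρ : Perm (Fin (p + e)), (sign ρ : ℤ) •
        (rowAlt T (desc (a + q) (q + p)) A (Fin.append I (J ∘ ρ ∘ Fin.castAdd e)) *
          rowAlt T (desc (a + e) e) E (J ∘ ρ ∘ Fin.natAdd p)) = 0 := by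
  refine eq_zero_of_nsmul (Fintype.card_ne_zero (α := Perm (Fin p))) ?_
  rw [Finset.smul_sum]
  have expand : ∀ ρ : Perm (Fin (p + e)), Fintype.card (Perm (Fin p)) • (sign ρ : ℤ) •
      (rowAlt T (desc (a + q) (q + p)) A (Fin.append I (J ∘ ρ ∘ Fin.castAdd e)) *
        rowAlt T (desc (a + e) e) E (J ∘ ρ ∘ Fin.natAdd p)) =
      ∑ σ : Perm (Fin (q + p)), (sign σ : ℤ) •
        (word T (desc (a + q) (q + p) ∘ Fin.castAdd p) (A ∘ σ ∘ Fin.castAdd p) I *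
          (sign ρ : ℤ) • (rowAlt T (desc (a + q) (q + p) ∘ Fin.natAdd q)
            (A ∘ σ ∘ Fin.natAdd q) (J ∘ ρ ∘ Fin.castAdd e) *
              rowAlt T (desc (a + e) e) E (J ∘ ρ ∘ Fin.natAdd p))) := by
    intro ρ
    rw [smul_comm, ← smul_mul_assoc, card_smul_rowAlt_append, Finset.sum_mul, Finset.smul_sum]
    refine Finset.sum_congr rfl fun σ _ => ?_
    rw [smul_mul_assoc, smul_comm, mul_smul_comm, mul_assoc]
  rw [Finset.sum_congr rfl fun ρ _ => expand ρ, Finset.sum_comm]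
  refine Finset.sum_eq_zero fun σ _ => ?_
  rw [← Finset.smul_sum, ← Finset.mul_sum]
  obtain ⟨j, hj⟩ := hAE ⟨σ (Fin.natAdd q ⟨0, hp⟩), rfl⟩
  have hc : desc (a + q) (q + p) ∘ Fin.natAdd q = desc a p := by
    funext k
    simp only [Function.comp_apply, desc, Fin.val_natAdd]
    push_cast
    ring
  have key := sum_sign_smul_minor_mul_minor_eq_zero hT a (A ∘ σ ∘ Fin.natAdd q) E J hj.symm
  rw [hc, key, mul_zero, smul_zero]

/-- The Young symmetry with parameters `u + d`, `u + e + 1`, as a sum over permutations of an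
arbitrary tuple `J`. For one exchanged column the two symmetries coincide, and the general case
follows by alternating first over the last exchanged column and the columns of the second minor,
the other exchanged columns being fixed. -/
theorem sum_sign_smul_rowAlt_append_eq_zero' (hT : IsRTT T) {q r e : ℕ} (a : ℂ)
    (A : Fin (q + (r + 1)) → ι) (E : Fin e → ι) (hAE : Set.range A ⊆ Set.range E)
    (I : Fin q → ι) (J : Fin (r + 1 + e) → ι) :
    ∑ ρ : Perm (Fin (r + 1 + e)), (sign ρ : ℤ) •
        (rowAlt T (desc (a + (q + r : ℕ)) (q + (r + 1))) A
            (Fin.append I (J ∘ ρ ∘ Fin.castAdd e)) *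
          rowAlt T (desc (a + e) e) E (J ∘ ρ ∘ Fin.natAdd (r + 1))) = 0 := by
  have h : r + (1 + e) = r + 1 + e := by omega
  -- The permutations that fix the first `r` indices.
  let φ : Perm (Fin (1 + e)) → Perm (Fin (r + 1 + e)) :=
    fun κ => (finCongr h).permCongr (blockPerm 1 κ)
  have hφ₁ : ∀ κ k, φ κ (Fin.castAdd e (Fin.castAdd 1 k)) = Fin.castAdd e (Fin.castAdd 1 k) := by
    intro κ k
    have : (finCongr h).symm (Fin.castAdd e (Fin.castAdd 1 k)) = Fin.castAdd (1 + e) k := rfl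
    simp only [φ, permCongr_apply, this, blockPerm_castAdd]
    rfl
  have hφ₂ : ∀ κ k, φ κ (Fin.castAdd e (Fin.natAdd r k)) =
      Fin.cast h (Fin.natAdd r (κ (Fin.castAdd e k))) := by
    intro κ k
    have : (finCongr h).symm (Fin.castAdd e (Fin.natAdd r k)) =
      Fin.natAdd r (Fin.castAdd e k) := rfl
    simp only [φ, permCongr_apply, this, blockPerm_natAdd]
    rfl
  have hφ₃ : ∀ κ k, φ κ (Fin.natAdd (r + 1) k) =
      Fin.cast h (Fin.natAdd r (κ (Fin.natAdd 1 k))) := by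
    intro κ k
    have : (finCongr h).symm (Fin.natAdd (r + 1) k) = Fin.natAdd r (Fin.natAdd 1 k) :=
      Fin.ext (by simp [add_assoc])
    simp only [φ, permCongr_apply, this, blockPerm_natAdd]
    rfl
  refine eq_zero_of_nsmul (Fintype.card_ne_zero (α := Perm (Fin (1 + e)))) ?_
  rw [card_smul_sum_sign φ]
  refine Finset.sum_eq_zero fun ρ _ => ?_
  let J' : Fin (1 + e) → ι := fun k => J (ρ (Fin.cast h (Fin.natAdd r k)))
  let I' : Fin (q + r) → ι :=
    Fin.append I fun k : Fin r => J (ρ (Fin.castAdd e (Fin.castAdd 1 k)))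
  have h₁ : ∀ κ, Fin.append I (J ∘ (ρ * φ κ) ∘ Fin.castAdd e) =
      Fin.append I' (J' ∘ κ ∘ Fin.castAdd e) := by
    intro κ
    have : J ∘ (ρ * φ κ) ∘ Fin.castAdd e =
        Fin.append (fun k : Fin r => J (ρ (Fin.castAdd e (Fin.castAdd 1 k))))
          (J' ∘ κ ∘ Fin.castAdd e) := by
      funext k
      induction k using Fin.addCases with
      | left k => simp [hφ₁]
      | right k => simp only [Fin.append_right, Function.comp_apply, Perm.mul_apply, hφ₂, J']
    rw [this, Fin.append_assoc]
    rfl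
  have h₂ : ∀ κ, J ∘ (ρ * φ κ) ∘ Fin.natAdd (r + 1) = J' ∘ κ ∘ Fin.natAdd 1 := by
    intro κ
    funext k
    simp only [Function.comp_apply, Perm.mul_apply, hφ₃, J']
  have key := sum_sign_smul_rowAlt_append_eq_zero hT one_pos a A E hAE I' J'
  simp only [h₁, h₂]
  have hs : ∀ κ, sign (φ κ) = sign κ := fun κ => by simp [φ, sign_permCongr]
  simp only [hs]
  exact (congrArg _ key).trans (smul_zero _)

end RTT

/-! ### Sums over subsets as sums over permutations -/

namespace Yangian

open Equiv Equiv.Perm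

/-- The sign of a permutation, as the parity of the number of inversions of the tuple that it
represents. -/
theorem sign_eq_neg_one_pow_tupleLength {n m : ℕ} {j : Fin m → Fin n} (hj : StrictMono j)
    (ρ : Perm (Fin m)) : (sign ρ : ℤ) = (-1) ^ tupleLength (j ∘ ρ) := by
  rw [sign_eq_prod_prod_Ioi, tupleLength, Finset.card_filter, ← Finset.prod_pow_eq_pow_sum,
    Fintype.prod_prod_type]
  push_cast
  refine Finset.prod_congr rfl fun a _ => ?_
  rw [← Finset.prod_subset (Finset.subset_univ (Finset.Ioi a))]
  · refine Finset.prod_congr rfl fun b hb => ?_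
    have hab : a < b := Finset.mem_Ioi.1 hb
    rcases (ρ.injective.ne hab.ne).lt_or_gt with h | h
    · simp [h, h.not_gt, hj.lt_iff_lt]
    · simp [h, h.not_gt, hj.lt_iff_lt, hab]
  · intro b _ hb
    have hab : ¬ a < b := fun h => hb (Finset.mem_Ioi.2 h)
    simp [hab]

/-- The concatenation `Λ | J∖Λ` is a rearrangement of the increasing tuple of `J`. -/
theorem exists_perm_append_sdiff {n p e : ℕ} {J Λ : Finset (Fin n)} (hJ : J.card = e + p)
    (hΛ : Λ ⊆ J ∧ Λ.card = p) :
    ∃ ρ : Perm (Fin (p + e)), J.orderEmbOfFin (hJ.trans (add_comm e p)) ∘ ρ =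
      Fin.append (Λ.orderEmbOfFin hΛ.2) ((J \ Λ).orderEmbOfFin (card_sdiff_eq hJ hΛ)) := by
  set t : Fin (p + e) → Fin n :=
    Fin.append (Λ.orderEmbOfFin hΛ.2) ((J \ Λ).orderEmbOfFin (card_sdiff_eq hJ hΛ)) with ht
  have hmem : ∀ k, t k ∈ J := by
    intro k
    induction k using Fin.addCases with
    | left k => simpa [ht] using hΛ.1 (Λ.orderEmbOfFin_mem hΛ.2 k)
    | right k =>
      simpa [ht] using
        (Finset.mem_sdiff.1 ((J \ Λ).orderEmbOfFin_mem (card_sdiff_eq hJ hΛ) k)).1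
  have hinj : Function.Injective t := by
    rw [ht, Fin.append_injective_iff]
    refine ⟨(Λ.orderEmbOfFin hΛ.2).injective,
      ((J \ Λ).orderEmbOfFin (card_sdiff_eq hJ hΛ)).injective, fun a b h => ?_⟩
    have h' := (J \ Λ).orderEmbOfFin_mem (card_sdiff_eq hJ hΛ) b
    rw [← h] at h'
    exact (Finset.mem_sdiff.1 h').2 (Λ.orderEmbOfFin_mem hΛ.2 a)
  let f : Fin (p + e) → Fin (p + e) := fun k =>
    (J.orderIsoOfFin (hJ.trans (add_comm e p))).symm ⟨t k, hmem k⟩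
  have hf : Function.Injective f := fun a b h => by
    have := (OrderIso.injective _) h
    exact hinj (Subtype.ext_iff.1 this)
  refine ⟨Equiv.ofBijective f (Finite.injective_iff_bijective.1 hf), ?_⟩
  funext k
  simp [f, ← Finset.coe_orderIsoOfFin_apply]

/-- An alternating sum over the subsets `Λ ⊆ J` of size `p`, up to a factor the same alternating
sum over the rearrangements of the increasing tuple of `J`. -/
theorem sum_sign_smul_comp_orderEmbOfFin {n p e : ℕ} {M : Type*} [AddCommGroup M]
    {J : Finset (Fin n)} (hJ : J.card = e + p)
    (Φ : (Fin p → Fin n) → (Fin e → Fin n) → M)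
    (hΦ₁ : ∀ (α : Perm (Fin p)) L K, Φ (L ∘ α) K = (sign α : ℤ) • Φ L K)
    (hΦ₂ : ∀ (β : Perm (Fin e)) L K, Φ L (K ∘ β) = (sign β : ℤ) • Φ L K) :
    ∑ ρ : Perm (Fin (p + e)), (sign ρ : ℤ) •
        Φ (J.orderEmbOfFin (hJ.trans (add_comm e p)) ∘ ρ ∘ Fin.castAdd e)
          (J.orderEmbOfFin (hJ.trans (add_comm e p)) ∘ ρ ∘ Fin.natAdd p) =
      Fintype.card (Perm (Fin p) × Perm (Fin e)) •
        ∑ Λ : {Λ : Finset (Fin n) // Λ ⊆ J ∧ Λ.card = p},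
          ((-1) ^ tupleLength (Fin.append (Λ.1.orderEmbOfFin Λ.2.2)
            ((J \ Λ.1).orderEmbOfFin (card_sdiff_eq hJ Λ.2))) : ℤ) •
            Φ (Λ.1.orderEmbOfFin Λ.2.2) ((J \ Λ.1).orderEmbOfFin (card_sdiff_eq hJ Λ.2)) := by
  set j := J.orderEmbOfFin (hJ.trans (add_comm e p)) with hj
  choose ρ hρ using fun Λ : {Λ : Finset (Fin n) // Λ ⊆ J ∧ Λ.card = p} =>
    exists_perm_append_sdiff hJ Λ.2
  have hρ₁ : ∀ Λ (k : Fin p), j (ρ Λ (Fin.castAdd e k)) = Λ.1.orderEmbOfFin Λ.2.2 k :=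
    fun Λ k => (congrFun (hρ Λ) (Fin.castAdd e k)).trans (by simp)
  have hρ₂ : ∀ Λ (k : Fin e), j (ρ Λ (Fin.natAdd p k)) =
      (J \ Λ.1).orderEmbOfFin (card_sdiff_eq hJ Λ.2) k :=
    fun Λ k => (congrFun (hρ Λ) (Fin.natAdd p k)).trans (by simp)
  let F : {Λ : Finset (Fin n) // Λ ⊆ J ∧ Λ.card = p} × (Perm (Fin p) × Perm (Fin e)) →
      Perm (Fin (p + e)) := fun x => ρ x.1 * RTT.blockPerm x.2.1 x.2.2
  -- The subset `Λ` is recovered from a rearrangement as the set of its first `p` entries.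
  have hΛ : ∀ x, Finset.univ.image (fun k : Fin p => j (F x (Fin.castAdd e k))) = x.1.1 := by
    rintro ⟨Λ, α, β⟩
    simp only [F, Perm.mul_apply, RTT.blockPerm_castAdd, hρ₁]
    conv_rhs => rw [← Λ.1.image_orderEmbOfFin_univ Λ.2.2, ← Finset.image_univ_equiv α,
      Finset.image_image]
    rfl
  have hF : Function.Injective F := by
    rintro ⟨Λ, α, β⟩ ⟨Λ', α', β'⟩ h
    obtain rfl : Λ = Λ' := Subtype.ext (by rw [← hΛ ⟨Λ, α, β⟩, h, hΛ])
    have hb : RTT.blockPerm α β = RTT.blockPerm α' β' := mul_left_cancel h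
    have hα : α = α' := Equiv.ext fun k => by
      simpa using congrArg (fun σ => σ (Fin.castAdd e k)) hb
    have hβ : β = β' := Equiv.ext fun k => by
      simpa using congrArg (fun σ => σ (Fin.natAdd p k)) hb
    rw [hα, hβ]
  have hcard : Fintype.card {Λ : Finset (Fin n) // Λ ⊆ J ∧ Λ.card = p} = (p + e).choose p := by
    rw [Fintype.card_of_subtype (J.powersetCard p) fun Λ => Finset.mem_powersetCard,
      Finset.card_powersetCard, hJ, add_comm]
  have hbij : Function.Bijective F := by
    rw [Fintype.bijective_iff_injective_and_card]
    refine ⟨hF, ?_⟩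
    simp only [Fintype.card_prod, hcard, Fintype.card_perm, Fintype.card_fin]
    rw [← mul_assoc]
    simpa using Nat.choose_mul_factorial_mul_factorial (Nat.le_add_right p e)
  rw [← hbij.sum_comp, Fintype.sum_prod_type, Finset.smul_sum]
  refine Finset.sum_congr rfl fun Λ _ => ?_
  rw [← Finset.card_univ, ← Finset.sum_const]
  refine Finset.sum_congr rfl fun x _ => ?_
  obtain ⟨α, β⟩ := x
  have h₁ : j ∘ F (Λ, α, β) ∘ Fin.castAdd e = Λ.1.orderEmbOfFin Λ.2.2 ∘ α := by
    funext k
    simp [F, hρ₁]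
  have h₂ : j ∘ F (Λ, α, β) ∘ Fin.natAdd p =
      (J \ Λ.1).orderEmbOfFin (card_sdiff_eq hJ Λ.2) ∘ β := by
    funext k
    simp [F, hρ₂]
  rw [h₁, h₂, hΦ₁, hΦ₂, ← hρ Λ, ← sign_eq_neg_one_pow_tupleLength j.strictMono]
  simp only [F, Perm.sign_mul, RTT.sign_blockPerm, Units.val_mul, mul_smul]
  rw [smul_comm (sign β : ℤ) (sign α : ℤ), RTT.sign_smul_sign_smul, RTT.sign_smul_sign_smul]

end Yangian

/-! ### The relation between the shifted generating series -/

namespace Yangian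

open PowerSeries

variable {n : ℕ}

section Substitution

variable {Y : Type*} [Ring Y]

/-- The coefficients of a product up to a given order only depend on the coefficients of the
factors up to that order. -/
theorem coeff_mul_congr {N : ℕ} {f f' g g' : Y⟦X⟧} (hf : ∀ k < N, coeff k f = coeff k f')
    (hg : ∀ k < N, coeff k g = coeff k g') : ∀ k < N, coeff k (f * g) = coeff k (f' * g') := by
  intro k hk
  rw [coeff_mul, coeff_mul]
  refine Finset.sum_congr rfl fun q hq => ?_
  have hq := Finset.HasAntidiagonal.mem_antidiagonal.1 hq
  rw [hf _ (by omega), hg _ (by omega)]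

variable [Algebra ℂ Y]

/-- Scalar power series are central. -/
theorem commute_map_algebraMap (f : ℂ⟦X⟧) (g : Y⟦X⟧) : Commute (map (algebraMap ℂ Y) f) g := by
  ext m
  rw [coeff_mul, coeff_mul, ← Finset.Nat.sum_antidiagonal_swap]
  refine Finset.sum_congr rfl fun q _ => ?_
  simp [coeff_map, Algebra.commutes]

/-- The series `∑_r g_r x^r` for a scalar power series `x` without constant term; the terms with
`r > m` do not contribute to the coefficient of order `m`. -/
noncomputable def substSeries (g : ℕ → Y) (x : ℂ⟦X⟧) : Y⟦X⟧ :=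
  mk fun m => ∑ r ∈ Finset.range (m + 1), coeff m (x ^ r) • g r

theorem coeff_mul_pow_eq_zero {x : ℂ⟦X⟧} (hx : X ∣ x) (f : ℂ⟦X⟧) {m r : ℕ} (h : m < r) :
    coeff m (f * x ^ r) = 0 :=
  X_pow_dvd_iff.1 ((pow_dvd_pow_of_dvd hx r).mul_left f) m h

theorem coeff_substSeries {x : ℂ⟦X⟧} (hx : X ∣ x) (g : ℕ → Y) {m N : ℕ} (h : m < N) :
    coeff m (substSeries g x) =
      coeff m (∑ r ∈ Finset.range N, map (algebraMap ℂ Y) (x ^ r) * C (g r)) := by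
  rw [substSeries, coeff_mk, map_sum]
  simp_rw [coeff_mul_C, coeff_map, ← Algebra.smul_def]
  refine Finset.sum_subset (Finset.range_mono h) fun r _ hr => ?_
  have := coeff_mul_pow_eq_zero hx 1 (m := m) (r := r) (by simpa using hr)
  rw [one_mul] at this
  rw [this, zero_smul]

theorem coeff_mul_substSeries_mul_substSeries {x y : ℂ⟦X⟧} (hx : X ∣ x) (hy : X ∣ y)
    (g h : ℕ → Y) (f : ℂ⟦X⟧) {m N : ℕ} (hN : m < N) :
    coeff m (map (algebraMap ℂ Y) f * (substSeries g x * substSeries h y)) =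
      ∑ r ∈ Finset.range N, ∑ s ∈ Finset.range N,
        coeff m (f * x ^ r * y ^ s) • (g r * h s) := by
  rw [coeff_mul_congr (N := N) (fun _ _ => rfl)
    (coeff_mul_congr (fun _ hk => coeff_substSeries hx g hk)
      fun _ hk => coeff_substSeries hy h hk) m hN]
  rw [Finset.sum_mul_sum, Finset.mul_sum, map_sum]
  refine Finset.sum_congr rfl fun r _ => ?_
  rw [Finset.mul_sum, map_sum]
  refine Finset.sum_congr rfl fun s _ => ?_
  have e : map (algebraMap ℂ Y) f * (map (algebraMap ℂ Y) (x ^ r) * C (g r) *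
      (map (algebraMap ℂ Y) (y ^ s) * C (h s))) =
      map (algebraMap ℂ Y) (f * x ^ r * y ^ s) * C (g r * h s) := by
    rw [mul_assoc (map (algebraMap ℂ Y) (x ^ r)), ← mul_assoc (C (g r)),
      ← (commute_map_algebraMap (y ^ s) (C (g r))).eq]
    simp only [map_mul, mul_assoc]
  rw [e, coeff_mul_C, coeff_map, Algebra.smul_def]

end Substitution

theorem X_dvd_shiftedInv (a : ℂ) : X ∣ shiftedInv a := dvd_mul_right _ _

theorem one_add_mul_inv (a : ℂ) :
    (1 + C a * X : ℂ⟦X⟧) * (1 + C a * X)⁻¹ = 1 :=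
  PowerSeries.mul_inv_cancel _ (by simp)

/-- The identity `(u + b)⁻¹ - (u + a)⁻¹ = (a - b) (u + a)⁻¹ (u + b)⁻¹`. -/
theorem shiftedInv_sub_shiftedInv (a b : ℂ) :
    shiftedInv b - shiftedInv a = C (a - b) * (shiftedInv a * shiftedInv b) := by
  have ha := one_add_mul_inv a
  have hb := one_add_mul_inv b
  rw [shiftedInv, shiftedInv, map_sub]
  generalize (1 + C a * X : ℂ⟦X⟧)⁻¹ = v at *
  generalize (1 + C b * X : ℂ⟦X⟧)⁻¹ = w at *
  linear_combination X * v * hb - X * w * ha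

theorem gen_zero (i j : Fin n) : (gen i j 0 : Yangian n) = if i = j then 1 else 0 := by
  rw [gen, yangianFreeGen]
  split_ifs <;> simp

theorem gen_rtt (i j k l : Fin n) (r s : ℕ) :
    (gen i j (r + 1) * gen k l s - gen k l s * gen i j (r + 1)) -
        (gen i j r * gen k l (s + 1) - gen k l (s + 1) * gen i j r) =
      (gen k j r * gen i l s - gen k j s * gen i l r : Yangian n) := by
  have h := RingQuot.mkAlgHom_rel ℂ (YangianRel.rtt i j k l r s)
  rw [Ring.lie_def, Ring.lie_def] at h
  simp only [map_sub, map_mul] at h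
  exact h

theorem eq_zero_of_map_shiftedInv_mul {a : ℂ} {W : (Yangian n)⟦X⟧}
    (h : map (algebraMap ℂ (Yangian n)) (shiftedInv a) * W = 0) : W = 0 := by
  have h' : map (algebraMap ℂ (Yangian n)) ((1 + C a * X) * shiftedInv a) * W = 0 := by
    rw [map_mul, mul_assoc, h, mul_zero]
  rw [shiftedInv, mul_left_comm, one_add_mul_inv, mul_one, map_X] at h'
  ext m
  rw [← coeff_succ_X_mul, h', map_zero, map_zero]

/-- The defining relations of the Yangian in terms of the shifted generating series. -/
theorem isRTT_series : RTT.IsRTT (series (n := n)) := by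
  intro i j k l a b
  set φ := map (algebraMap ℂ (Yangian n))
  set x := shiftedInv a with hx
  set y := shiftedInv b with hy
  have hX : X ∣ x := X_dvd_shiftedInv a
  have hY : X ∣ y := X_dvd_shiftedInv b
  -- Multiplied by `x y`, the claim becomes a comparison of two expansions in `x` and `y`.
  have key : φ (y - x) * (series i j a * series k l b - series k l b * series i j a) =
      φ (x * y) * (series k j a * series i l b - series k j b * series i l a) := by
    ext m
    let c : ℕ → ℕ → Yangian n := fun r s => gen i j r * gen k l s - gen k l s * gen i j r
    have hc₀ : ∀ s, c 0 s = 0 := fun s => by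
      simp only [c, gen_zero]
      split_ifs <;> simp
    have hc₀' : ∀ r, c r 0 = 0 := fun r => by
      simp only [c, gen_zero]
      split_ifs <;> simp
    have h₁ : ∀ f : ℂ⟦X⟧,
        coeff m (φ f * (series i j a * series k l b - series k l b * series i j a)) =
          ∑ r ∈ Finset.range (m + 1), ∑ s ∈ Finset.range (m + 1),
            coeff m (f * x ^ r * y ^ s) • c r s := by
      intro f
      have e₁ := coeff_mul_substSeries_mul_substSeries hX hY (gen i j : ℕ → Yangian n) (gen k l)
        f m.lt_succ_self
      have e₂ := coeff_mul_substSeries_mul_substSeries hY hX (gen k l : ℕ → Yangian n) (gen i j)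
        f m.lt_succ_self
      rw [Finset.sum_comm] at e₂
      simp_rw [mul_right_comm f (y ^ _)] at e₂
      rw [mul_sub, map_sub]
      refine (congrArg₂ _ e₁ e₂).trans ?_
      simp only [c, smul_sub, Finset.sum_sub_distrib]
    have h₂ : coeff m (φ (x * y) * (series k j a * series i l b - series k j b * series i l a)) =
          ∑ r ∈ Finset.range (m + 1), ∑ s ∈ Finset.range (m + 1),
            coeff m (x * y * x ^ r * y ^ s) • (c (r + 1) s - c r (s + 1)) := by
      have e₁ := coeff_mul_substSeries_mul_substSeries hX hY (gen k j : ℕ → Yangian n) (gen i l)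
        (x * y) m.lt_succ_self
      have e₂ := coeff_mul_substSeries_mul_substSeries hY hX (gen k j : ℕ → Yangian n) (gen i l)
        (x * y) m.lt_succ_self
      rw [Finset.sum_comm] at e₂
      simp_rw [mul_right_comm (x * y) (y ^ _)] at e₂
      rw [mul_sub, map_sub]
      refine (congrArg₂ _ e₁ e₂).trans ?_
      simp only [c, gen_rtt, smul_sub, Finset.sum_sub_distrib]
    -- Shifting one summation index by one only drops boundary terms, which vanish.
    have shift₁ : ∑ r ∈ Finset.range (m + 1), ∑ s ∈ Finset.range (m + 1),
          coeff m (x * y * x ^ r * y ^ s) • c (r + 1) s =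
        ∑ r ∈ Finset.range (m + 1), ∑ s ∈ Finset.range (m + 1),
          coeff m (y * x ^ r * y ^ s) • c r s := by
      rw [Finset.sum_comm, Finset.sum_comm (s := Finset.range (m + 1)) (t := Finset.range (m + 1))
        (f := fun r s => coeff m (y * x ^ r * y ^ s) • c r s)]
      refine Finset.sum_congr rfl fun s _ => ?_
      have e := Finset.sum_range_succ (fun r => coeff m (y * x ^ r * y ^ s) • c r s) (m + 1)
      rw [Finset.sum_range_succ', hc₀, smul_zero, add_zero, mul_right_comm y,
        coeff_mul_pow_eq_zero hX _ m.lt_succ_self, zero_smul, add_zero] at e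
      rw [← e]
      refine Finset.sum_congr rfl fun r _ => ?_
      congr 2
      ring
    have shift₂ : ∑ r ∈ Finset.range (m + 1), ∑ s ∈ Finset.range (m + 1),
          coeff m (x * y * x ^ r * y ^ s) • c r (s + 1) =
        ∑ r ∈ Finset.range (m + 1), ∑ s ∈ Finset.range (m + 1),
          coeff m (x * x ^ r * y ^ s) • c r s := by
      refine Finset.sum_congr rfl fun r _ => ?_
      have e := Finset.sum_range_succ (fun s => coeff m (x * x ^ r * y ^ s) • c r s) (m + 1)
      rw [Finset.sum_range_succ', hc₀', smul_zero, add_zero,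
        coeff_mul_pow_eq_zero hY _ m.lt_succ_self, zero_smul, add_zero] at e
      rw [← e]
      refine Finset.sum_congr rfl fun s _ => ?_
      congr 2
      ring
    rw [h₂]
    simp_rw [smul_sub, Finset.sum_sub_distrib]
    rw [shift₁, shift₂, ← h₁, ← h₁, map_sub, sub_mul, map_sub]
  rw [← sub_eq_zero]
  refine eq_zero_of_map_shiftedInv_mul (a := b) (eq_zero_of_map_shiftedInv_mul (a := a) ?_)
  rw [shiftedInv_sub_shiftedInv, map_mul, map_C] at key
  have hs : ∀ W : (Yangian n)⟦X⟧, (a - b) • W = C (algebraMap ℂ (Yangian n) (a - b)) * W := by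
    intro W
    ext m
    rw [coeff_C_mul, coeff_smul, Algebra.smul_def]
  rw [← mul_assoc, ← map_mul, mul_sub, ← key, hs, ← mul_assoc, sub_eq_zero]
  congr 1
  exact commute_map_algebraMap _ _

end Yangian

/-! ### The Young symmetries -/

namespace Yangian

open Equiv Equiv.Perm

theorem topMinor_eq_rowAlt {n d : ℕ} (hd : d ≤ n) (J : Fin d → Fin n) (a : ℂ) :
    topMinor hd J a = RTT.rowAlt series (RTT.desc a d) (Fin.castLE hd) J :=
  rfl

theorem topMinor_comp_perm {n d : ℕ} (hd : d ≤ n) (J : Fin d → Fin n) (a : ℂ)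
    (β : Perm (Fin d)) : topMinor hd (J ∘ β) a = (sign β : ℤ) • topMinor hd J a := by
  rw [topMinor_eq_rowAlt, topMinor_eq_rowAlt]
  exact RTT.rowAlt_comp_col isRTT_series RTT.desc_sub_desc _ J β

theorem topMinor_append_comp_perm {n d q p : ℕ} (hq : q + p = d) (hd : d ≤ n) (I : Fin q → Fin n)
    (L : Fin p → Fin n) (a : ℂ) (α : Perm (Fin p)) :
    topMinor hd (fun k => Fin.append I (L ∘ α) (Fin.cast hq.symm k)) a =
      (sign α : ℤ) • topMinor hd (fun k => Fin.append I L (Fin.cast hq.symm k)) a := by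
  subst hq
  have h : Fin.append I (L ∘ α) = Fin.append I L ∘ RTT.blockPerm 1 α := by
    funext k
    induction k using Fin.addCases <;> simp
  have h' := topMinor_comp_perm hd (Fin.append I L) a (RTT.blockPerm 1 α)
  rw [← h, RTT.sign_blockPerm, map_one, one_mul] at h'
  exact h'

/-- The alternating sum over subsets vanishes as soon as the corresponding sum over all
rearrangements of `J` does. -/
theorem youngSum_eq_zero {n d e p : ℕ} (hpd : p ≤ d) (hde : d ≤ e)
    (I : Fin (d - p) → Fin n) (J : Finset (Fin n)) (hJ : J.card = e + p) (a b : ℂ)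
    (h : ∀ (q : ℕ) (hq : q + p = d) (I : Fin q → Fin n) (J : Fin (p + e) → Fin n)
        (hd : d ≤ n) (he : e ≤ n),
      ∑ ρ : Perm (Fin (p + e)), (sign ρ : ℤ) •
        (topMinor hd
            (fun k => Fin.append I (J ∘ ρ ∘ Fin.castAdd e) (Fin.cast hq.symm k)) a *
          topMinor he (J ∘ ρ ∘ Fin.natAdd p) b) = 0) :
    youngSum hpd hde I J hJ a b = 0 := by
  have he : e ≤ n := le_of_card_eq hJ
  have hq : d - p + p = d := Nat.sub_add_cancel hpd
  have key := sum_sign_smul_comp_orderEmbOfFin hJ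
    (fun L K => topMinor (hde.trans he) (fun k => Fin.append I L (Fin.cast hq.symm k)) a *
      topMinor he K b)
    (fun α L K => by rw [topMinor_append_comp_perm hq, smul_mul_assoc])
    (fun β L K => by rw [topMinor_comp_perm, mul_smul_comm])
  rw [h _ hq I _ (hde.trans he) he] at key
  have hzero := RTT.eq_zero_of_nsmul Fintype.card_ne_zero key.symm
  rw [youngSum, ← hzero]
  refine Finset.sum_congr rfl fun Λ _ => ?_
  rw [zsmul_eq_mul]
  push_cast
  rfl

theorem range_castLE_subset {n d e : ℕ} (hde : d ≤ e) (hd : d ≤ n) (he : e ≤ n) :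
    Set.range (Fin.castLE hd) ⊆ Set.range (Fin.castLE he) := by
  rintro _ ⟨k, rfl⟩
  exact ⟨Fin.castLE hde k, rfl⟩

end Yangian

theorem mainTheorem3 (n d e p : ℕ) (hp : 0 < p) (hpd : p ≤ d) (hde : d ≤ e)
    (I : Fin (d - p) → Fin n) (J : Finset (Fin n)) (hJ : J.card = e + p) :
    Yangian.youngSum hpd hde I J hJ (d : ℂ) ((e : ℂ) + 1) = 0 ∧
      Yangian.youngSum hpd hde I J hJ (d : ℂ) ((e : ℂ) + p) = 0 := by
  constructor
  · refine Yangian.youngSum_eq_zero hpd hde I J hJ _ _ fun q hq I' J' hd he => ?_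
    obtain ⟨r, rfl⟩ : ∃ r, p = r + 1 := ⟨p - 1, by omega⟩
    subst hq
    have key := RTT.sum_sign_smul_rowAlt_append_eq_zero' Yangian.isRTT_series (1 : ℂ)
      (Fin.castLE hd) (Fin.castLE he) (Yangian.range_castLE_subset hde hd he) I' J'
    have h₁ : (1 : ℂ) + (q + r : ℕ) = (q + (r + 1) : ℕ) := by
      push_cast
      ring
    rw [h₁, add_comm (1 : ℂ)] at key
    simp only [Yangian.topMinor_eq_rowAlt]
    exact key
  · refine Yangian.youngSum_eq_zero hpd hde I J hJ _ _ fun q hq I' J' hd he => ?_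
    subst hq
    have key := RTT.sum_sign_smul_rowAlt_append_eq_zero Yangian.isRTT_series hp (p : ℂ)
      (Fin.castLE hd) (Fin.castLE he) (Yangian.range_castLE_subset hde hd he) I' J'
    have h₁ : (p : ℂ) + q = (q + p : ℕ) := by
      push_cast
      ring
    rw [h₁, add_comm (p : ℂ)] at key
    simp only [Yangian.topMinor_eq_rowAlt]
    exact key
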